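/- Let $(\mathcal X,\langle\cdot,\cdot\rangle)$ be a separable real Hilbert space and let $f:\mathcal X\to\mathbb R$ be convex and continuously differentiable with globally Lipschitz gradient and $\operatorname{argmin} f\neq\emptyset$; let $x_*$ be the minimizer of $f$ of minimal norm. For $\lambda>0$ let $x_\lambda$ be the unique minimizer of $f_\lambda(x)=f(x)+\frac{\lambda}{2}\|x\|^2$. Let $C_\alpha,C_\lambda>0$, $p\in(0,\frac13)$, $q\in(\frac{p+1}{2},1-p)$, and set $\alpha_k=C_\alpha k^{-q}$, $\lambda_k=C_\lambda k^{-p}$ for $k\ge 1$. On a probability space with filtration $(\mathcal F_k)_{k\ge0}$ let $(X_k)_{k\ge0}$ be an adapted sequence with $\mathbb E\|X_0\|^2<\infty$ and $$X_k=X_{k-1}-\alpha_k\big(\nabla f(X_{k-1})+\lambda_kX_{k-1}+D_k\big),\qquad k\ge1,$$ where $(D_k)_{k\ge1}$ is adapted and integrable with $\mathbb E[D_k\mid\mathcal F_{k-1}]=0$ for all $k\ge1$, and where, for some constants $A,C\ge0$, $\mathbb E[\|D_k\|^2\mid\mathcal F_{k-1}]\le A\,(f(X_{k-1})-f(x_*))+C$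 for all $k\ge1$. Assume moreover that there are $\xi>0$ and $C_{\mathrm{reg}}>0$ with $\|x_\lambda-x_*\|\le C_{\mathrm{reg}}\lambda^{\xi}$ for all $\lambda\in(0,1]$. Then for every $\beta\in(0,2q-1)$, $$\|X_k-x_*\|^2=\mathcal O\big(k^{-\min(1-q-p,\ \beta-p,\ 2\xi p)}\big)\quad\text{almost surely.}$$ In particular, if $q=\frac23$ and $p=\frac1{6\xi+3}$, then for every $\varepsilon>0$, $$\|X_k-x_*\|^2=\mathcal O\big(k^{-\frac{2\xi}{6\xi+3}+\varepsilon}\big)\quad\text{almost surely.}$$ -/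

import Mathlib

open MeasureTheory ProbabilityTheory Filter Set Asymptotics
open scoped Gradient ENNReal Topology

namespace RegSGD

/-- `f` is convex, continuously differentiable, has a globally Lipschitz gradient with some
constant `L > 0`, and has at least one global minimizer. -/
structure SmoothConvex {E : Type*} [NormedAddCommGroup E] [InnerProductSpace ℝ E]
    [CompleteSpace E] (f : E → ℝ) : Prop where
  convex : ConvexOn ℝ univ f
  contDiff : ContDiff ℝ 1 f
  smooth : ∃ L : ℝ, 0 < L ∧ ∀ x y : E, ‖∇ f x - ∇ f y‖ ≤ L * ‖x - y‖
  argmin_nonempty : ∃ x : E, IsMinOn f univ x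

/-- `xs` is a global minimizer of `f` whose norm is minimal among all global minimizers. -/
def IsMinNormSolution {E : Type*} [NormedAddCommGroup E] (f : E → ℝ) (xs : E) : Prop :=
  IsMinOn f univ xs ∧ ∀ y : E, IsMinOn f univ y → ‖xs‖ ≤ ‖y‖

/-- The Tikhonov regularized objective `f_lam(x) = f(x) + lam / 2 * ‖x‖ ^ 2`. -/
noncomputable def tikhonov {E : Type*} [NormedAddCommGroup E] (f : E → ℝ) (lam : ℝ) (x : E) : ℝ :=
  f x + lam / 2 * ‖x‖ ^ 2

/-- The Tikhonov minimizers approach `xs` with rate `lam ^ ξ`: there is `Creg > 0` such that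
`‖x_lam - xs‖ ≤ Creg * lam ^ ξ` for all `lam ∈ (0, 1]`, where `x_lam` is the minimizer of
`tikhonov f lam` (which is unique when `f` is convex). -/
def TikhonovRate {E : Type*} [NormedAddCommGroup E] (f : E → ℝ) (xs : E) (ξ : ℝ) : Prop :=
  ∃ Creg : ℝ, 0 < Creg ∧ ∀ lam ∈ Ioc (0 : ℝ) 1, ∀ x_lam : E,
    IsMinOn (tikhonov f lam) univ x_lam → ‖x_lam - xs‖ ≤ Creg * lam ^ ξ

/-- `X` is generated by regularized stochastic gradient descent with deterministic step sizes
`α k`, regularization parameters `lam k` and noise `D k`, `k ≥ 1`: the initial state is square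
integrable, `X` is adapted, the noise is a sequence of (adapted, integrable) martingale
differences, and `X_k = X_{k-1} - α_k (∇f(X_{k-1}) + lam_k X_{k-1} + D_k)` almost surely, for all
`k ≥ 1`. The values `α 0`, `lam 0`, `D 0` are not used. -/
structure IsRegSGD {E : Type*} [NormedAddCommGroup E] [InnerProductSpace ℝ E] [CompleteSpace E]
    {Ω : Type*} {mΩ : MeasurableSpace Ω} (P : Measure Ω) (ℱ : Filtration ℕ mΩ)
    (f : E → ℝ) (α lam : ℕ → ℝ) (X D : ℕ → Ω → E) : Prop where
  init : MemLp (X 0) 2 P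
  adapted : ∀ k : ℕ, StronglyMeasurable[ℱ k] (X k)
  noise_adapted : ∀ k : ℕ, StronglyMeasurable[ℱ (k + 1)] (D (k + 1))
  noise_integrable : ∀ k : ℕ, Integrable (D (k + 1)) P
  noise_condExp : ∀ k : ℕ, P[D (k + 1)|ℱ k] =ᵐ[P] 0
  step : ∀ k : ℕ, ∀ᵐ ω ∂P, X (k + 1) ω =
    X k ω - α (k + 1) • (∇ f (X k ω) + lam (k + 1) • X k ω + D (k + 1) ω)

/-- The second moment condition on the noise: there are `A, C ≥ 0` such that
`𝔼[‖D_k‖ ^ 2 | ℱ_{k-1}] ≤ A (f(X_{k-1}) - f(xs)) + C` almost surely for all `k ≥ 1`. The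
conditional expectation is the `[0, ∞]`-valued one, so that finiteness of the conditional
second moment is part of the condition. -/
def ABCCondition {E : Type*} [NormedAddCommGroup E]
    {Ω : Type*} {mΩ : MeasurableSpace Ω} (P : Measure Ω) (ℱ : Filtration ℕ mΩ)
    (f : E → ℝ) (xs : E) (X D : ℕ → Ω → E) : Prop :=
  ∃ A C : ℝ, 0 ≤ A ∧ 0 ≤ C ∧ ∀ k : ℕ, ∀ᵐ ω ∂P,
    condLExp (ℱ k) P (fun ω' => ‖D (k + 1) ω'‖ₑ ^ 2) ω
      ≤ ENNReal.ofReal (A * (f (X k ω) - f xs) + C)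

end RegSGD

namespace RegSGD

/-! ### Convexity, regularized gradient steps and Tikhonov minimizers -/

section Deterministic

variable {E : Type*} [NormedAddCommGroup E] [InnerProductSpace ℝ E] [CompleteSpace E]
  {f : E → ℝ}

/-! Write `α_k`, `λ_k` for step size and regularization. The error splits along a deterministic
reference `y_k`, the same recursion without noise (`gdIter`), and the Tikhonov minimizer `x_{λ_k}`:
`X_k - x_* = (X_k - y_k) + (y_k - x_{λ_k}) + (x_{λ_k} - x_*)`.

Everything rests on one contraction estimate (`SmoothConvex.norm_regStep_sub_sq_le`): a regularized
gradient step shrinks squared distances by `1 - 2αλ + O(α²)`, where `α_k λ_k` has order `k^(-(q+p))`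
and dominates `α_k²` because `p < q`.

For `X_k - y_k`, both sequences take the same step, so only the centred noise separates them. Its
conditional second moment contributes `O(α_k²)` plus a multiple of `α_k² ‖X_k - y_k‖²`, which the
contraction absorbs. Since `q + p < 1`, the contraction also beats the growth of `k^β`, so `k^β ‖X_k
- y_k‖²` is a nonnegative almost supermartingale with errors `k^(β-2q)`, summable for `β < 2q - 1`;
it is therefore almost surely bounded.

For `y_k - x_{λ_k}`, the target moves by `O(1/k)` per step (`SmoothConvex.mul_norm_sub_le`), and
contraction at rate `k^(-(q+p))` against it leaves `O(k^(-(1-q-p)))`. The last term is the assumed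
Tikhonov rate. -/

lemma SmoothConvex.hasGradientAt (hf : SmoothConvex f) (x : E) : HasGradientAt f (∇ f x) x :=
  (hf.contDiff.differentiable one_ne_zero x).hasGradientAt

/-- The gradient inequality for convex functions. -/
lemma SmoothConvex.add_inner_gradient_le (hf : SmoothConvex f) (x y : E) :
    f x + inner ℝ (∇ f x) (y - x) ≤ f y := by
  have hline : HasDerivAt (fun t : ℝ => f (x + t • (y - x))) (inner ℝ (∇ f x) (y - x)) 0 := by
    have h1 : HasDerivAt (fun t : ℝ => x + t • (y - x)) (y - x) 0 := by
      simpa using ((hasDerivAt_id (0 : ℝ)).smul_const (y - x)).const_add x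
    have h2 : HasFDerivAt f (InnerProductSpace.toDual ℝ E (∇ f x)) (x + (0 : ℝ) • (y - x)) := by
      simpa using (hf.hasGradientAt x).hasFDerivAt
    simpa only [InnerProductSpace.toDual_apply_apply] using! h2.comp_hasDerivAt (0 : ℝ) h1
  have hconv : ConvexOn ℝ univ (fun t : ℝ => f (x + t • (y - x))) := by
    have := hf.convex.comp_affineMap (AffineMap.lineMap x y : ℝ →ᵃ[ℝ] E)
    simpa [Function.comp_def, AffineMap.lineMap_apply, add_comm] using this
  have h := hconv.le_slope_of_hasDerivAt (mem_univ 0) (mem_univ 1) zero_lt_one hline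
  simp only [slope_def_field, one_smul, zero_smul, add_zero, add_sub_cancel, sub_zero,
    div_one] at h
  linarith

/-- The gradient of a convex function is monotone. -/
lemma SmoothConvex.inner_gradient_sub_nonneg (hf : SmoothConvex f) (x y : E) :
    0 ≤ inner ℝ (∇ f x - ∇ f y) (x - y) := by
  have h1 := hf.add_inner_gradient_le x y
  have h2 := hf.add_inner_gradient_le y x
  rw [← neg_sub x y, inner_neg_right] at h1
  rw [inner_sub_left]
  linarith

lemma gradient_eq_zero_of_isMinOn {x : E} (hx : IsMinOn f univ x) : ∇ f x = 0 := by
  have : IsLocalMin f x := hx.isLocalMin univ_mem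
  rw [gradient, this.fderiv_eq_zero, map_zero]

/-- Gradient inequality at `x`, Cauchy–Schwarz and `∇ f xs = 0`. This turns the noise condition into
a bound by squared distances; the sharp constant `L / 2` is not needed. -/
lemma SmoothConvex.sub_le_mul_norm_sq (hf : SmoothConvex f) {L : ℝ}
    (hL : ∀ x y : E, ‖∇ f x - ∇ f y‖ ≤ L * ‖x - y‖) {xs : E} (hxs : IsMinOn f univ xs) (x : E) :
    f x - f xs ≤ L * ‖x - xs‖ ^ 2 := by
  have h1 := hf.add_inner_gradient_le x xs
  have h2 := hL x xs
  rw [gradient_eq_zero_of_isMinOn hxs, sub_zero] at h2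
  have h3 := abs_real_inner_le_norm (∇ f x) (xs - x)
  rw [norm_sub_rev xs x] at h3
  have h4 := neg_abs_le (inner ℝ (∇ f x) (xs - x))
  have h5 := mul_le_mul_of_nonneg_right h2 (norm_nonneg (x - xs))
  nlinarith

/-- One step of gradient descent, with step size `a`, for the Tikhonov regularized objective with
regularization parameter `l`. -/
noncomputable def regStep (f : E → ℝ) (a l : ℝ) (x : E) : E := x - a • (∇ f x + l • x)

lemma regStep_eq_self {a l : ℝ} {x : E} (hx : ∇ f x + l • x = 0) : regStep f a l x = x := by
  simp [regStep, hx]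

/-- Expand the square: monotonicity of `∇ f` makes the regularized gradient `l`-strongly monotone,
which bounds the cross term, and its Lipschitz constant `L + l` bounds the quadratic one. -/
lemma SmoothConvex.norm_regStep_sub_sq_le (hf : SmoothConvex f) {L a l : ℝ}
    (hL : ∀ x y : E, ‖∇ f x - ∇ f y‖ ≤ L * ‖x - y‖) (ha : 0 ≤ a) (hl : 0 ≤ l) (x y : E) :
    ‖regStep f a l x - regStep f a l y‖ ^ 2
      ≤ (1 - 2 * (a * l) + a ^ 2 * (L + l) ^ 2) * ‖x - y‖ ^ 2 := by
  set g := (∇ f x - ∇ f y) + l • (x - y) with hg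
  have e : regStep f a l x - regStep f a l y = (x - y) - a • g := by
    simp only [regStep, hg, smul_sub, smul_add]; abel
  have h1 : l * ‖x - y‖ ^ 2 ≤ inner ℝ (x - y) g := by
    rw [hg, inner_add_right, real_inner_comm, inner_smul_right, real_inner_self_eq_norm_sq]
    linarith [hf.inner_gradient_sub_nonneg x y]
  have h2 : ‖g‖ ≤ (L + l) * ‖x - y‖ := by
    calc ‖g‖ ≤ ‖∇ f x - ∇ f y‖ + ‖l • (x - y)‖ := norm_add_le _ _
      _ ≤ L * ‖x - y‖ + l * ‖x - y‖ := by
        rw [norm_smul, Real.norm_of_nonneg hl]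
        gcongr
        exact hL x y
      _ = _ := by ring
  have h3 : ‖g‖ ^ 2 ≤ (L + l) ^ 2 * ‖x - y‖ ^ 2 := by
    rw [← mul_pow]; exact pow_le_pow_left₀ (norm_nonneg _) h2 2
  rw [e, norm_sub_sq_real, inner_smul_right, norm_smul, mul_pow, Real.norm_of_nonneg ha]
  have h4 := mul_le_mul_of_nonneg_left h1 ha
  have h5 := mul_le_mul_of_nonneg_left h3 (sq_nonneg a)
  nlinarith

/-- The regularized objective has a stationary point. -/
lemma SmoothConvex.exists_stationary (hf : SmoothConvex f) {l : ℝ} (hl : 0 < l) :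
    ∃ x : E, ∇ f x + l • x = 0 := by
  obtain ⟨L, hL0, hL⟩ := hf.smooth
  -- This step size minimizes the contraction factor, which becomes `1 - a * l`; Banach's fixed
  -- point theorem then yields the stationary point.
  set a := l / (L + l) ^ 2 with ha
  have hLl : 0 < L + l := by positivity
  have ha0 : 0 < a := by positivity
  have hal : a ^ 2 * (L + l) ^ 2 = a * l := by rw [ha]; field_simp
  have hK : 1 - 2 * (a * l) + a ^ 2 * (L + l) ^ 2 = 1 - a * l := by rw [hal]; ring
  have hal0 : 0 < a * l := by positivity
  have hal1 : a * l ≤ 1 := by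
    rw [ha, div_mul_eq_mul_div, div_le_one (by positivity)]
    nlinarith
  have hcontr : ContractingWith (Real.toNNReal (√(1 - a * l))) (regStep f a l) := by
    refine ⟨?_, LipschitzWith.of_dist_le_mul fun x y => ?_⟩
    · rw [← NNReal.coe_lt_coe, Real.coe_toNNReal _ (Real.sqrt_nonneg _), NNReal.coe_one,
        Real.sqrt_lt' one_pos]
      linarith
    · rw [Real.coe_toNNReal _ (Real.sqrt_nonneg _), dist_eq_norm, dist_eq_norm,
        ← Real.sqrt_sq (norm_nonneg (x - y)), ← Real.sqrt_mul (by linarith)]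
      refine Real.le_sqrt_of_sq_le ?_
      rw [← hK]
      exact hf.norm_regStep_sub_sq_le hL ha0.le hl.le x y
  have hfix := hcontr.fixedPoint_isFixedPt.eq
  rw [regStep, sub_eq_self, smul_eq_zero] at hfix
  exact ⟨_, hfix.resolve_left ha0.ne'⟩

lemma SmoothConvex.isMinOn_tikhonov (hf : SmoothConvex f) {l : ℝ} (hl : 0 ≤ l) {x : E}
    (hx : ∇ f x + l • x = 0) : IsMinOn (tikhonov f l) univ x := by
  intro y _
  have h1 := hf.add_inner_gradient_le x y
  rw [eq_neg_of_add_eq_zero_left hx, inner_neg_left, inner_smul_left, inner_sub_right,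
    real_inner_self_eq_norm_sq] at h1
  have h2 : 0 ≤ ‖y - x‖ ^ 2 := sq_nonneg _
  rw [norm_sub_sq_real, real_inner_comm] at h2
  simp only [mem_ofPred_eq, tikhonov, RCLike.conj_to_real] at h1 ⊢
  nlinarith

-- Comparing the regularized values at `x` and `xs` gives a bound uniform in `l`, which controls the
-- drift of the regularized path.
omit [InnerProductSpace ℝ E] [CompleteSpace E] in
lemma norm_le_of_isMinOn_tikhonov {l : ℝ} (hl : 0 < l) {x xs : E} (hxs : IsMinOn f univ xs)
    (hx : IsMinOn (tikhonov f l) univ x) : ‖x‖ ≤ ‖xs‖ := by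
  have h1 : f xs ≤ f x := hxs (mem_univ x)
  have h2 : tikhonov f l x ≤ tikhonov f l xs := hx (mem_univ xs)
  simp only [tikhonov] at h2
  refine le_of_sq_le_sq ?_ (norm_nonneg _)
  nlinarith

/-- Lipschitz dependence of the regularized solution on the regularization parameter. -/
lemma SmoothConvex.mul_norm_sub_le (hf : SmoothConvex f) {l m : ℝ} {x y : E}
    (hx : ∇ f x + l • x = 0) (hy : ∇ f y + m • y = 0) :
    l * ‖x - y‖ ≤ |l - m| * ‖y‖ := by
  rcases (norm_nonneg (x - y)).eq_or_lt with h0 | h0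
  · rw [← h0, mul_zero]; positivity
  have h1 := hf.inner_gradient_sub_nonneg x y
  -- Subtract the two stationarity equations; monotonicity then bounds `l * ‖x - y‖ ^ 2` by a term
  -- linear in `‖x - y‖`.
  have e : ∇ f x - ∇ f y = -(l • (x - y)) - (l - m) • y := by
    rw [eq_neg_of_add_eq_zero_left hx, eq_neg_of_add_eq_zero_left hy, smul_sub, sub_smul]; abel
  rw [e, inner_sub_left, inner_neg_left, real_inner_smul_left, real_inner_smul_left,
    real_inner_self_eq_norm_sq] at h1
  have h2 : -((l - m) * inner ℝ y (x - y)) ≤ |l - m| * (‖y‖ * ‖x - y‖) := by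
    refine (neg_le_abs _).trans ?_
    rw [abs_mul]
    gcongr
    exact abs_real_inner_le_norm _ _
  refine le_of_mul_le_mul_right ?_ h0
  nlinarith

end Deterministic

/-! ### Power sequences and a scalar recursion -/

section PowerSequences

lemma tendsto_natCast_rpow_neg {s : ℝ} (hs : 0 < s) :
    Tendsto (fun k : ℕ => (k : ℝ) ^ (-s)) atTop (𝓝 0) :=
  (tendsto_rpow_neg_atTop hs).comp tendsto_natCast_atTop_atTop

lemma rpow_add_one_le {x β : ℝ} (hx : 0 < x) (h0 : 0 ≤ β) (h1 : β ≤ 1) :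
    (x + 1) ^ β ≤ x ^ β * (1 + 1 / x) := by
  have e : x + 1 = x * (1 + 1 / x) := by field_simp
  have h : (1 + 1 / x) ^ β ≤ 1 + β * (1 / x) :=
    rpow_one_add_le_one_add_mul_self (by linarith [one_div_pos.2 hx]) h0 h1
  have h' : β * (1 / x) ≤ 1 / x := mul_le_of_le_one_left (by positivity) h1
  rw [e, Real.mul_rpow hx.le (by positivity)]
  gcongr
  linarith

lemma rpow_neg_le_rpow_neg_add_one {x r : ℝ} (hx : 0 < x) (h0 : 0 ≤ r) (h1 : r ≤ 1) :
    x ^ (-r) ≤ (x + 1) ^ (-r) * (1 + 1 / x) := by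
  have h := rpow_add_one_le hx h0 h1
  have hx1 : 0 < (x + 1) ^ r := by positivity
  have hx0 : 0 < x ^ r := by positivity
  rw [Real.rpow_neg hx.le, Real.rpow_neg (by positivity), inv_mul_eq_div, inv_eq_one_div,
    div_le_div_iff₀ hx0 hx1]
  linarith

lemma rpow_neg_le_two_mul {x r : ℝ} (hx : 1 ≤ x) (h0 : 0 ≤ r) (h1 : r ≤ 1) :
    x ^ (-r) ≤ 2 * (x + 1) ^ (-r) := by
  have hx0 : 0 < x := by linarith
  have h := rpow_neg_le_rpow_neg_add_one hx0 h0 h1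
  have h2 : 1 / x ≤ 1 := by rw [div_le_one (by linarith)]; exact hx
  have h3 : 0 ≤ (x + 1) ^ (-r) := by positivity
  nlinarith

/-- The weight grows by at most `1 + 1/k`, while `c k^(-γ) ≥ 1/k` eventually because `γ < 1`, and
`(1 + 1/k)(1 - 1/k) ≤ 1`. -/
lemma eventually_rpow_add_one_mul_le {β c γ : ℝ} (h0 : 0 ≤ β) (h1 : β ≤ 1) (hc : 0 < c)
    (hγ : γ < 1) :
    ∀ᶠ k : ℕ in atTop, ((k : ℝ) + 1) ^ β * (1 - c * (k : ℝ) ^ (-γ)) ≤ (k : ℝ) ^ β := by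
  have ht := (tendsto_natCast_rpow_neg (sub_pos.2 hγ)).eventually_le_const hc
  filter_upwards [ht, eventually_ge_atTop 1] with k hk hk1
  have hk0 : (0 : ℝ) < k := by exact_mod_cast hk1
  have h2 : 1 / (k : ℝ) ≤ c * (k : ℝ) ^ (-γ) := by
    have e : 1 / (k : ℝ) = (k : ℝ) ^ (-(1 - γ)) * (k : ℝ) ^ (-γ) := by
      rw [← Real.rpow_add hk0, one_div, ← Real.rpow_neg_one]; congr 1; ring
    rw [e]; gcongr
  rcases le_total (1 - c * (k : ℝ) ^ (-γ)) 0 with h3 | h3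
  · exact (mul_nonpos_of_nonneg_of_nonpos (by positivity) h3).trans (by positivity)
  · have h5 : (0 : ℝ) < 1 / k := by positivity
    calc ((k : ℝ) + 1) ^ β * (1 - c * (k : ℝ) ^ (-γ))
        ≤ ((k : ℝ) ^ β * (1 + 1 / k)) * (1 - 1 / k) := by
          gcongr
          exact rpow_add_one_le hk0 h0 h1
      _ = (k : ℝ) ^ β * (1 - (1 / k) ^ 2) := by ring
      _ ≤ (k : ℝ) ^ β * 1 := by gcongr; nlinarith
      _ = _ := mul_one _

/-- A sequence contracting with rates `1 - c k ^ (-γ)` up to errors of order `1 / k` is of order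
`k ^ (-(1 - γ))`. -/
lemma exists_eventually_le_of_recursion {z : ℕ → ℝ} {c C γ : ℝ} (hc : 0 < c) (hγ0 : 0 < γ)
    (hγ : γ < 1)
    (hz : ∀ᶠ k : ℕ in atTop, z (k + 1) ≤ (1 - c * (k : ℝ) ^ (-γ)) * z k + C / k) :
    ∃ M : ℝ, ∀ᶠ k : ℕ in atTop, z k ≤ M * (k : ℝ) ^ (-(1 - γ)) := by
  have hw := eventually_rpow_add_one_mul_le (β := 1 - γ) (by linarith) (by linarith)
    (half_pos hc) hγ
  have ht := (tendsto_natCast_rpow_neg hγ0).eventually_le_const (inv_pos.2 hc)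
  obtain ⟨N, hN⟩ := eventually_atTop.1 (hz.and (hw.and (ht.and (eventually_ge_atTop 1))))
  have hNpos : (0 : ℝ) < N := by exact_mod_cast (hN N le_rfl).2.2.2
  -- The first entry lets half of the contraction absorb the error `C / k`; the last starts the
  -- induction at `N`. The other half of the contraction pays for the decay of the bound in `h6`.
  set M := max (max (2 * C / c) 0) (z N * (N : ℝ) ^ (1 - γ)) with hM
  have hM0 : 0 ≤ M := (le_max_right _ _).trans (le_max_left _ _)
  have hMC : C ≤ c / 2 * M := by
    have : 2 * C / c ≤ M := (le_max_left _ _).trans (le_max_left _ _)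
    rw [div_le_iff₀ hc] at this
    linarith
  refine ⟨M, eventually_atTop.2 ⟨N, fun k hk => ?_⟩⟩
  induction k, hk using Nat.le_induction with
  | base =>
    rw [Real.rpow_neg hNpos.le, ← div_eq_mul_inv, le_div_iff₀ (by positivity)]
    exact le_max_right _ _
  | succ k hk ih =>
    obtain ⟨h1, h2, h3, h4⟩ := hN k hk
    have hk0 : (0 : ℝ) < k := by exact_mod_cast h4
    have h5 : 0 ≤ 1 - c * (k : ℝ) ^ (-γ) := by
      have := mul_le_mul_of_nonneg_left h3 hc.le
      rw [mul_inv_cancel₀ hc.ne'] at this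
      linarith
    have e : (k : ℝ) ^ (-γ) * (k : ℝ) ^ (-(1 - γ)) = 1 / k := by
      rw [← Real.rpow_add hk0, one_div, ← Real.rpow_neg_one]; congr 1; ring
    have h6 : (1 - c / 2 * (k : ℝ) ^ (-γ)) * (k : ℝ) ^ (-(1 - γ))
        ≤ ((k : ℝ) + 1) ^ (-(1 - γ)) := by
      have hk1 : (0 : ℝ) < k + 1 := by linarith
      rw [Real.rpow_neg hk0.le (1 - γ), Real.rpow_neg hk1.le, ← div_eq_mul_inv, inv_eq_one_div,
        div_le_div_iff₀ (by positivity) (by positivity)]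
      linarith
    calc z (k + 1) ≤ (1 - c * (k : ℝ) ^ (-γ)) * z k + C / k := h1
      _ ≤ (1 - c * (k : ℝ) ^ (-γ)) * (M * (k : ℝ) ^ (-(1 - γ))) + (c / 2 * M) / k := by gcongr
      _ = M * ((1 - c / 2 * (k : ℝ) ^ (-γ)) * (k : ℝ) ^ (-(1 - γ))) := by
        rw [div_eq_mul_one_div (c / 2 * M), ← e]; ring
      _ ≤ M * ((k : ℝ) + 1) ^ (-(1 - γ)) := by gcongr
      _ = _ := by push_cast; rfl

/-- Second-order terms are negligible against the contraction: `k^(-2q)` is of lower order than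
`k^(-(q+p))`. -/
lemma eventually_sq_mul_le {Ca Cl p q : ℝ} (hCa : 0 < Ca) (hCl : 0 < Cl) (hpq : p < q) (K : ℝ) :
    ∀ᶠ k : ℕ in atTop, (Ca * (k : ℝ) ^ (-q)) ^ 2 * K
      ≤ (Ca * (k : ℝ) ^ (-q)) * (Cl * (k : ℝ) ^ (-p)) := by
  have ht := ((tendsto_natCast_rpow_neg (sub_pos.2 hpq)).const_mul (Ca * K))
  rw [mul_zero] at ht
  filter_upwards [ht.eventually_le_const hCl, eventually_ge_atTop 1] with k hk hk1
  have hk0 : (0 : ℝ) < k := by exact_mod_cast hk1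
  have e : (k : ℝ) ^ (-q) = (k : ℝ) ^ (-(q - p)) * (k : ℝ) ^ (-p) := by
    rw [← Real.rpow_add hk0]; congr 1; ring
  calc (Ca * (k : ℝ) ^ (-q)) ^ 2 * K
      = (Ca * (k : ℝ) ^ (-q)) * ((Ca * K * (k : ℝ) ^ (-(q - p))) * (k : ℝ) ^ (-p)) := by
        rw [sq]; nth_rw 2 [e]; ring
    _ ≤ _ := by gcongr

lemma half_mul_rpow_neg_le_mul {Ca Cl p q x : ℝ} (hCa : 0 < Ca) (hCl : 0 < Cl) (hx : 1 ≤ x)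
    (h0 : 0 ≤ q + p) (h1 : q + p ≤ 1) :
    Ca * Cl / 2 * x ^ (-(q + p)) ≤ (Ca * (x + 1) ^ (-q)) * (Cl * (x + 1) ^ (-p)) := by
  have h := mul_le_mul_of_nonneg_left (rpow_neg_le_two_mul hx h0 h1)
    (by positivity : 0 ≤ Ca * Cl / 2)
  have hx0 : 0 < x + 1 := by linarith
  have e : (Ca * (x + 1) ^ (-q)) * (Cl * (x + 1) ^ (-p)) = Ca * Cl * (x + 1) ^ (-(q + p)) := by
    rw [neg_add, Real.rpow_add hx0]; ring
  rw [e]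
  linarith

end PowerSequences

/-! ### The noiseless reference sequence -/

section Reference

variable {E : Type*} [NormedAddCommGroup E] [InnerProductSpace ℝ E] [CompleteSpace E]
  {f : E → ℝ} {Ca Cl p q : ℝ}

/-- The deterministic regularized gradient iterates, started at `0`. -/
noncomputable def gdIter (f : E → ℝ) (α lam : ℕ → ℝ) : ℕ → E
  | 0 => 0
  | k + 1 => regStep f (α (k + 1)) (lam (k + 1)) (gdIter f α lam k)

lemma mul_rpow_neg_le {C x r : ℝ} (hC : 0 ≤ C) (hx : 1 ≤ x) (hr : 0 ≤ r) :
    C * x ^ (-r) ≤ C :=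
  mul_le_of_le_one_right hC (Real.rpow_le_one_of_one_le_of_nonpos hx (by linarith))

/-- The deterministic regularized gradient iterates track the regularized minimizers. -/
lemma SmoothConvex.exists_eventually_norm_gdIter_sub_le (hf : SmoothConvex f)
    (hCa : 0 < Ca) (hCl : 0 < Cl) (hp0 : 0 < p) (hp1 : p ≤ 1) (hpq : p < q) (hqp : q + p < 1)
    {xl : ℕ → E}
    (hxl : ∀ k : ℕ, 1 ≤ k → ∇ f (xl k) + (Cl * (k : ℝ) ^ (-p)) • xl k = 0)
    {R : ℝ} (hR : ∀ k : ℕ, 1 ≤ k → ‖xl k‖ ≤ R) :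
    ∃ M : ℝ, ∀ᶠ k : ℕ in atTop,
      ‖gdIter f (fun k => Ca * (k : ℝ) ^ (-q)) (fun k => Cl * (k : ℝ) ^ (-p)) k - xl k‖
        ≤ M * (k : ℝ) ^ (-(1 - (q + p))) := by
  obtain ⟨L, hL0, hL⟩ := hf.smooth
  -- One factor `1/2` comes from passing to unsquared norms, the other from replacing `k + 1` by
  -- `k`.
  refine exists_eventually_le_of_recursion (c := Ca * Cl / 4) (C := R) (by positivity)
    (by linarith) hqp ?_
  have hsm := (tendsto_add_atTop_nat 1).eventually
    (eventually_sq_mul_le hCa hCl hpq ((L + Cl) ^ 2))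
  filter_upwards [hsm, eventually_ge_atTop 1] with k hk hk1
  have hk0 : (1 : ℝ) ≤ k := by exact_mod_cast hk1
  have hkpos : (0 : ℝ) < k := by linarith
  have hk2 : (1 : ℝ) ≤ ((k + 1 : ℕ) : ℝ) := by push_cast; linarith
  rw [gdIter]
  set y := gdIter f (fun k => Ca * (k : ℝ) ^ (-q)) (fun k => Cl * (k : ℝ) ^ (-p)) k
  have hlCl := mul_rpow_neg_le hCl.le hk2 hp0.le
  set a := Ca * ((k + 1 : ℕ) : ℝ) ^ (-q) with ha
  set l := Cl * ((k + 1 : ℕ) : ℝ) ^ (-p) with hl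
  have ha0 : 0 < a := by positivity
  have hl0 : 0 < l := by positivity
  have hal : a ^ 2 * (L + l) ^ 2 ≤ a * l := le_trans (by gcongr) hk
  have hal1 : a * l ≤ 1 := by
    have : (a * l) ^ 2 ≤ a * l := by
      rw [mul_pow]
      exact le_trans (by gcongr; linarith) hal
    have h0 : 0 < a * l := by positivity
    nlinarith
  -- The minimizer is a fixed point of the step, and the squared factor is at most `1 - a * l ≤ (1 -
  -- a * l / 2) ^ 2`.
  have hstep : ‖regStep f a l y - xl (k + 1)‖ ≤ (1 - a * l / 2) * ‖y - xl (k + 1)‖ := by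
    refine le_of_sq_le_sq ?_ (mul_nonneg (by linarith) (norm_nonneg _))
    have hfix : regStep f a l (xl (k + 1)) = xl (k + 1) := regStep_eq_self (hxl (k + 1) (by omega))
    nth_rw 1 [← hfix]
    refine (hf.norm_regStep_sub_sq_le hL ha0.le hl0.le y (xl (k + 1))).trans ?_
    rw [mul_pow (1 - a * l / 2)]
    gcongr
    nlinarith [sq_nonneg (a * l)]
  have hdrift : ‖xl k - xl (k + 1)‖ ≤ R / k := by
    have h1 := hf.mul_norm_sub_le (hxl (k + 1) (by omega)) (hxl k hk1)
    have h2 := rpow_neg_le_rpow_neg_add_one hkpos hp0.le hp1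
    have h3 : |l - Cl * (k : ℝ) ^ (-p)| ≤ l * (1 / k) := by
      rw [abs_sub_comm, abs_of_nonneg]
      · have := mul_le_mul_of_nonneg_left h2 hCl.le
        rw [hl]; push_cast
        linarith
      · rw [hl, sub_nonneg]
        refine mul_le_mul_of_nonneg_left ?_ hCl.le
        exact Real.rpow_le_rpow_of_nonpos hkpos (by push_cast; linarith) (by linarith)
    have h4 : l * ‖xl (k + 1) - xl k‖ ≤ l * (R / k) :=
      calc _ ≤ |l - Cl * (k : ℝ) ^ (-p)| * ‖xl k‖ := h1
        _ ≤ l * (1 / k) * R := by gcongr; exact hR k hk1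
        _ = _ := by ring
    rw [norm_sub_rev]
    exact le_of_mul_le_mul_left h4 hl0
  have hrate : Ca * Cl / 4 * (k : ℝ) ^ (-(q + p)) ≤ a * l / 2 := by
    have h1 := half_mul_rpow_neg_le_mul hCa hCl hk0 (by linarith : 0 ≤ q + p) hqp.le
    rw [ha, hl]; push_cast
    linarith
  have hR0 : 0 ≤ R / k := (norm_nonneg _).trans hdrift
  calc ‖regStep f a l y - xl (k + 1)‖ ≤ (1 - a * l / 2) * ‖y - xl (k + 1)‖ := hstep
    _ ≤ (1 - a * l / 2) * (‖y - xl k‖ + R / k) := by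
      gcongr
      · linarith
      · exact (norm_sub_le_norm_sub_add_norm_sub _ (xl k) _).trans (by gcongr)
    _ ≤ (1 - a * l / 2) * ‖y - xl k‖ + R / k := by
      have : 0 < a * l := by positivity
      nlinarith
    _ ≤ _ := by gcongr

end Reference

/-! ### Almost supermartingales and the one-step noise estimate -/

section Stochastic

variable {Ω : Type*} {mΩ : MeasurableSpace Ω} {P : Measure Ω} {ℱ : Filtration ℕ mΩ}

/-- A nonnegative adapted process whose conditional drift is eventually bounded by a summable
deterministic sequence is almost surely bounded. -/
lemma ae_exists_forall_le_of_setIntegral_succ_le [IsProbabilityMeasure P] {Y : ℕ → Ω → ℝ}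
    (hadp : StronglyAdapted ℱ Y) (hint : ∀ k, Integrable (Y k) P) (hnn : ∀ k ω, 0 ≤ Y k ω)
    {u : ℕ → ℝ} (hu0 : ∀ k, 0 ≤ u k) (hu : Summable u) {N : ℕ}
    (h : ∀ k, N ≤ k → ∀ A : Set Ω, MeasurableSet[ℱ k] A →
      ∫ ω in A, Y (k + 1) ω ∂P ≤ ∫ ω in A, Y k ω ∂P + u k * P.real A) :
    ∀ᵐ ω ∂P, ∃ B : ℝ, ∀ k, N ≤ k → Y k ω ≤ B := by
  let 𝒢 : Filtration ℕ mΩ :=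
    ⟨fun j => ℱ (N + j), fun i j hij => ℱ.mono (by omega), fun j => ℱ.le _⟩
  set c := ∫ ω, Y N ω ∂P with hc
  let S : ℕ → ℝ := fun j => ∑ i ∈ Finset.range j, u (N + i)
  have hS : ∀ j, S j ≤ ∑' k, u (N + k) := fun j =>
    (hu.comp_injective (add_right_injective N)).sum_le_tsum _ fun i _ => hu0 _
  -- Compensating by the accumulated errors and flipping the sign gives a submartingale with `W 0`
  -- of mean zero and a constant upper bound, hence bounded in `L¹`. Its almost sure convergence
  -- bounds `Y` above.
  let W : ℕ → Ω → ℝ := fun j ω => (c + S j) - Y (N + j) ω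
  have hWint : ∀ j, Integrable (W j) P := fun j => (integrable_const _).sub (hint _)
  have hsub : Submartingale W 𝒢 P := by
    refine submartingale_of_setIntegral_le_succ
      (fun j => stronglyMeasurable_const.sub (hadp (N + j))) hWint fun j A hA => ?_
    have h1 := h (N + j) (by omega) A hA
    simp only [W]
    rw [integral_sub (integrable_const _) (hint _).integrableOn,
      integral_sub (integrable_const _) (hint _).integrableOn, setIntegral_const,
      setIntegral_const]
    have e : S (j + 1) = S j + u (N + j) := Finset.sum_range_succ _ _
    rw [e, smul_eq_mul, smul_eq_mul, ← add_assoc N j 1]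
    linarith
  have hbdd : ∀ j, eLpNorm (W j) 1 P ≤
      ((c + ∑' k, u (N + k)).toNNReal + (c + ∑' k, u (N + k)).toNNReal : NNReal) := by
    intro j
    refine (eLpNorm_one_le_of_le' (r := c + ∑' k, u (N + k)) (hWint j) ?_ ?_).trans ?_
    · have h0 := hsub.setIntegral_le (Nat.zero_le j) (MeasurableSet.univ)
      rw [setIntegral_univ, setIntegral_univ] at h0
      refine le_trans (le_of_eq ?_) h0
      simp only [W]
      rw [integral_sub (integrable_const _) (hint _)]
      simp [S, hc]
    · refine ae_of_all _ fun ω => ?_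
      have := hnn (N + j) ω
      have := hS j
      simp only [W]
      linarith
    · rw [measure_univ, mul_one, two_mul, ENNReal.coe_add]; rfl
  filter_upwards [hsub.exists_ae_tendsto_of_bdd hbdd] with ω ⟨l, hl⟩
  obtain ⟨b, hb⟩ := hl.bddBelow_range
  refine ⟨c + (∑' k, u (N + k)) - b, fun k hk => ?_⟩
  obtain ⟨j, rfl⟩ := Nat.exists_eq_add_of_le hk
  have h1 : b ≤ W j ω := hb (mem_range_self j)
  have h2 := hS j
  simp only [W] at h1
  linarith

variable {E : Type*} [NormedAddCommGroup E] [InnerProductSpace ℝ E] [CompleteSpace E]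

omit [CompleteSpace E] in
lemma integrable_inner_of_memLp {w d : Ω → E} (hw : MemLp w 2 P) (hd : MemLp d 2 P) :
    Integrable (fun ω => inner ℝ (w ω) (d ω)) P :=
  (hw.norm.integrable_mul hd.norm).mono'
    (hw.aestronglyMeasurable.inner hd.aestronglyMeasurable)
    (ae_of_all _ fun ω => norm_inner_le_norm (w ω) (d ω))

/-- Conditionally centred noise is orthogonal to the past. -/
lemma setIntegral_norm_sub_smul_sq [IsFiniteMeasure P] {m : MeasurableSpace Ω} (hm : m ≤ mΩ)
    {w d : Ω → E} (hwm : StronglyMeasurable[m] w) (hw : MemLp w 2 P) (hd : MemLp d 2 P)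
    (hd0 : P[d|m] =ᵐ[P] 0) (a : ℝ) {A : Set Ω} (hA : MeasurableSet[m] A) :
    ∫ ω in A, ‖w ω - a • d ω‖ ^ 2 ∂P
      = ∫ ω in A, ‖w ω‖ ^ 2 ∂P + a ^ 2 * ∫ ω in A, ‖d ω‖ ^ 2 ∂P := by
  have hin := integrable_inner_of_memLp hw hd
  have hcross : ∫ ω in A, inner ℝ (w ω) (d ω) ∂P = 0 := by
    have h1 : P[fun ω => inner ℝ (w ω) (d ω)|m] =ᵐ[P] fun ω => inner ℝ (w ω) (P[d|m] ω) :=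
      condExp_bilin_of_stronglyMeasurable_left (innerSL ℝ) hwm hin
        (hd.integrable one_le_two)
    rw [← setIntegral_condExp hm hin hA]
    refine (integral_eq_zero_of_ae (ae_restrict_of_ae ?_))
    filter_upwards [h1, hd0] with ω h1 h2
    rw [h1, h2]
    simp
  have hw2 := (memLp_two_iff_integrable_sq_norm hw.aestronglyMeasurable).1 hw
  have hd2 := (memLp_two_iff_integrable_sq_norm hd.aestronglyMeasurable).1 hd
  have e : ∀ ω, ‖w ω - a • d ω‖ ^ 2
      = (‖w ω‖ ^ 2 - 2 * a * inner ℝ (w ω) (d ω)) + a ^ 2 * ‖d ω‖ ^ 2 := fun ω => by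
    rw [norm_sub_sq_real, inner_smul_right, norm_smul, mul_pow, Real.norm_eq_abs, sq_abs]
    ring
  simp_rw [e]
  have hsub : Integrable (fun ω => ‖w ω‖ ^ 2 - 2 * a * inner ℝ (w ω) (d ω)) P :=
    hw2.sub (hin.const_mul _)
  rw [integral_add hsub.integrableOn (hd2.const_mul _).integrableOn,
    integral_sub hw2.integrableOn (hin.const_mul _).integrableOn, integral_const_mul,
    integral_const_mul, hcross, mul_zero, sub_zero]

-- Stated with `[0, ∞]`-valued integrals so that square integrability of `d` is not presupposed;
-- taking `A` to be everything will prove it.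
omit [InnerProductSpace ℝ E] [CompleteSpace E] in
lemma setLIntegral_enorm_sq_le [IsFiniteMeasure P] {m : MeasurableSpace Ω} (hm : m ≤ mΩ)
    {d : Ω → E} {G : Ω → ℝ} (hG : Integrable G P) (hG0 : 0 ≤ᵐ[P] G)
    (h : ∀ᵐ ω ∂P, condLExp m P (fun ω' => ‖d ω'‖ₑ ^ 2) ω ≤ ENNReal.ofReal (G ω))
    {A : Set Ω} (hA : MeasurableSet[m] A) :
    ∫⁻ ω in A, ‖d ω‖ₑ ^ 2 ∂P ≤ ENNReal.ofReal (∫ ω in A, G ω ∂P) := by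
  rw [← setLIntegral_condLExp hm P _ hA,
    ofReal_integral_eq_lintegral_ofReal hG.integrableOn (ae_restrict_of_ae hG0)]
  exact lintegral_mono_ae (ae_restrict_of_ae h)

omit [InnerProductSpace ℝ E] [CompleteSpace E] in
lemma memLp_two_of_condLExp_le [IsFiniteMeasure P] {m : MeasurableSpace Ω} (hm : m ≤ mΩ)
    {d : Ω → E} (hd : AEStronglyMeasurable[mΩ] d P) {G : Ω → ℝ} (hG : Integrable G P)
    (hG0 : 0 ≤ᵐ[P] G)
    (h : ∀ᵐ ω ∂P, condLExp m P (fun ω' => ‖d ω'‖ₑ ^ 2) ω ≤ ENNReal.ofReal (G ω)) :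
    MemLp d 2 P := by
  refine ⟨hd, ?_⟩
  rw [eLpNorm_lt_top_iff_lintegral_rpow_enorm_lt_top two_ne_zero ENNReal.ofNat_ne_top]
  have := setLIntegral_enorm_sq_le hm hG hG0 h MeasurableSet.univ
  rw [setLIntegral_univ] at this
  simpa using this.trans_lt ENNReal.ofReal_lt_top

omit [InnerProductSpace ℝ E] [CompleteSpace E] in
lemma setIntegral_norm_sq_le_of_condLExp_le [IsFiniteMeasure P] {m : MeasurableSpace Ω}
    (hm : m ≤ mΩ) {d : Ω → E} (hd : AEStronglyMeasurable[mΩ] d P) {G : Ω → ℝ} (hG : Integrable G P)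
    (hG0 : 0 ≤ᵐ[P] G)
    (h : ∀ᵐ ω ∂P, condLExp m P (fun ω' => ‖d ω'‖ₑ ^ 2) ω ≤ ENNReal.ofReal (G ω))
    {A : Set Ω} (hA : MeasurableSet[m] A) :
    ∫ ω in A, ‖d ω‖ ^ 2 ∂P ≤ ∫ ω in A, G ω ∂P := by
  have h1 := setLIntegral_enorm_sq_le hm hG hG0 h hA
  rw [integral_eq_lintegral_of_nonneg_ae (ae_of_all _ fun ω => sq_nonneg _)
    (hd.norm.pow 2).restrict]
  refine ENNReal.toReal_le_of_le_ofReal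
    (integral_nonneg_of_ae (ae_restrict_of_ae hG0)) (le_trans (le_of_eq ?_) h1)
  refine lintegral_congr fun ω => ?_
  rw [ENNReal.ofReal_pow (norm_nonneg _), ofReal_norm]

variable {f : E → ℝ} {α lam : ℕ → ℝ} {X D : ℕ → Ω → E}

lemma continuous_gradient {L : ℝ} (hL0 : 0 < L)
    (hL : ∀ x y : E, ‖∇ f x - ∇ f y‖ ≤ L * ‖x - y‖) : Continuous (∇ f) :=
  (LipschitzWith.of_dist_le_mul (K := L.toNNReal) fun x y => by
    rw [dist_eq_norm, dist_eq_norm, Real.coe_toNNReal _ hL0.le]; exact hL x y).continuous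

lemma continuous_regStep {L : ℝ} (hL0 : 0 < L)
    (hL : ∀ x y : E, ‖∇ f x - ∇ f y‖ ≤ L * ‖x - y‖) (a l : ℝ) :
    Continuous (regStep f a l) := by
  have h := continuous_gradient hL0 hL
  unfold regStep
  fun_prop

lemma memLp_regStep_comp [IsFiniteMeasure P] {L : ℝ} (hL0 : 0 < L)
    (hL : ∀ x y : E, ‖∇ f x - ∇ f y‖ ≤ L * ‖x - y‖) (a l : ℝ) {Z : Ω → E} (hZ : MemLp Z 2 P) :
    MemLp (fun ω => regStep f a l (Z ω)) 2 P := by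
  have h := continuous_gradient hL0 hL
  have h1 : MemLp (fun ω => ∇ f (Z ω) - ∇ f 0) 2 P :=
    hZ.of_le_mul ((h.comp_aestronglyMeasurable hZ.1).sub aestronglyMeasurable_const)
      (c := L) (ae_of_all _ fun ω => by simpa using hL (Z ω) 0)
  have h2 : MemLp (fun ω => ∇ f (Z ω)) 2 P := by
    exact (h1.add (memLp_const (∇ f 0))).ae_eq (ae_of_all _ fun ω => by simp)
  exact hZ.sub ((h2.add (hZ.const_smul l)).const_smul a)

lemma condLExp_noise_le (hf : SmoothConvex f) {L A C : ℝ}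
    (hL : ∀ x y : E, ‖∇ f x - ∇ f y‖ ≤ L * ‖x - y‖) (hA : 0 ≤ A) {xs : E}
    (hxs : IsMinOn f univ xs) {k : ℕ}
    (hD : ∀ᵐ ω ∂P, condLExp (ℱ k) P (fun ω' => ‖D (k + 1) ω'‖ₑ ^ 2) ω
      ≤ ENNReal.ofReal (A * (f (X k ω) - f xs) + C)) :
    ∀ᵐ ω ∂P, condLExp (ℱ k) P (fun ω' => ‖D (k + 1) ω'‖ₑ ^ 2) ω
      ≤ ENNReal.ofReal (A * (L * ‖X k ω - xs‖ ^ 2) + C) := by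
  filter_upwards [hD] with ω h
  refine h.trans (ENNReal.ofReal_le_ofReal ?_)
  gcongr
  exact hf.sub_le_mul_norm_sq hL hxs _

omit [InnerProductSpace ℝ E] [CompleteSpace E] in
lemma integrable_norm_sub_sq [IsFiniteMeasure P] {Z : Ω → E} (hZ : MemLp Z 2 P) (x : E) :
    Integrable (fun ω => ‖Z ω - x‖ ^ 2) P := by
  have h := hZ.sub (memLp_const x)
  exact (memLp_two_iff_integrable_sq_norm h.1).1 h

lemma IsRegSGD.memLp_noise [IsFiniteMeasure P] (hX : IsRegSGD P ℱ f α lam X D)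
    (hf : SmoothConvex f) {L A C : ℝ} (hL0 : 0 < L)
    (hL : ∀ x y : E, ‖∇ f x - ∇ f y‖ ≤ L * ‖x - y‖) (hA : 0 ≤ A) (hC : 0 ≤ C) {xs : E}
    (hxs : IsMinOn f univ xs) {k : ℕ} (hXk : MemLp (X k) 2 P)
    (hD : ∀ᵐ ω ∂P, condLExp (ℱ k) P (fun ω' => ‖D (k + 1) ω'‖ₑ ^ 2) ω
      ≤ ENNReal.ofReal (A * (f (X k ω) - f xs) + C)) :
    MemLp (D (k + 1)) 2 P :=
  memLp_two_of_condLExp_le (ℱ.le k) (hX.noise_integrable k).1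
    ((((integrable_norm_sub_sq hXk xs).const_mul L).const_mul A).add (integrable_const C))
    (ae_of_all _ fun ω => by simp only [Pi.zero_apply, Pi.add_apply]; positivity)
    (condLExp_noise_le hf hL hA hxs hD)

lemma IsRegSGD.step_eq (hX : IsRegSGD P ℱ f α lam X D) (k : ℕ) :
    X (k + 1) =ᵐ[P] fun ω =>
      regStep f (α (k + 1)) (lam (k + 1)) (X k ω) - α (k + 1) • D (k + 1) ω := by
  filter_upwards [hX.step k] with ω h
  rw [h, regStep, smul_add (α (k + 1)) _ (D (k + 1) ω), sub_add_eq_sub_sub]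

/-- The noise bound is quadratic in `X k`, so square integrability passes from `X k` to `D (k + 1)`
and then to `X (k + 1)`. -/
lemma IsRegSGD.memLp [IsFiniteMeasure P] (hX : IsRegSGD P ℱ f α lam X D)
    (hf : SmoothConvex f) {xs : E} (hxs : IsMinOn f univ xs)
    (hD : ABCCondition P ℱ f xs X D) (k : ℕ) : MemLp (X k) 2 P := by
  obtain ⟨L, hL0, hL⟩ := hf.smooth
  obtain ⟨A, C, hA, hC, hD⟩ := hD
  induction k with
  | zero => exact hX.init
  | succ k ih =>
    have h := (memLp_regStep_comp hL0 hL (α (k + 1)) (lam (k + 1)) ih).sub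
      ((hX.memLp_noise hf hL0 hL hA hC hxs ih (hD k)).const_smul (α (k + 1)))
    exact h.ae_eq (hX.step_eq k).symm

/-- One-step estimate for the distance to a deterministic regularized gradient step. -/
lemma IsRegSGD.setIntegral_norm_sub_regStep_sq_le [IsFiniteMeasure P]
    (hX : IsRegSGD P ℱ f α lam X D) (hf : SmoothConvex f) {L A C : ℝ} (hL0 : 0 < L)
    (hL : ∀ x y : E, ‖∇ f x - ∇ f y‖ ≤ L * ‖x - y‖) (hA : 0 ≤ A) (hC : 0 ≤ C) {xs : E}
    (hxs : IsMinOn f univ xs) {k : ℕ} (hXk : MemLp (X k) 2 P)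
    (hD : ∀ᵐ ω ∂P, condLExp (ℱ k) P (fun ω' => ‖D (k + 1) ω'‖ₑ ^ 2) ω
      ≤ ENNReal.ofReal (A * (f (X k ω) - f xs) + C))
    (hα : 0 ≤ α (k + 1)) (hlam : 0 ≤ lam (k + 1)) {y : E} {R : ℝ} (hy : ‖y - xs‖ ≤ R)
    {S : Set Ω} (hS : MeasurableSet[ℱ k] S) :
    ∫ ω in S, ‖X (k + 1) ω - regStep f (α (k + 1)) (lam (k + 1)) y‖ ^ 2 ∂P
      ≤ (1 - 2 * (α (k + 1) * lam (k + 1))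
          + α (k + 1) ^ 2 * ((L + lam (k + 1)) ^ 2 + 2 * (A * L)))
          * ∫ ω in S, ‖X k ω - y‖ ^ 2 ∂P
        + α (k + 1) ^ 2 * (2 * (A * L) * R ^ 2 + C) * P.real S := by
  set a := α (k + 1)
  set l := lam (k + 1)
  have hDm := hX.memLp_noise hf hL0 hL hA hC hxs hXk hD
  have hwm : StronglyMeasurable[ℱ k] fun ω => regStep f a l (X k ω) - regStep f a l y :=
    ((continuous_regStep hL0 hL a l).comp_stronglyMeasurable (hX.adapted k)).sub
      stronglyMeasurable_const
  have hw : MemLp (fun ω => regStep f a l (X k ω) - regStep f a l y) 2 P :=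
    (memLp_regStep_comp hL0 hL a l hXk).sub (memLp_const _)
  have h1 : ∫ ω in S, ‖X (k + 1) ω - regStep f a l y‖ ^ 2 ∂P
      = ∫ ω in S, ‖(regStep f a l (X k ω) - regStep f a l y) - a • D (k + 1) ω‖ ^ 2 ∂P := by
    refine integral_congr_ae (ae_restrict_of_ae ?_)
    filter_upwards [hX.step_eq k] with ω h
    rw [h, sub_right_comm]
  have hV := integrable_norm_sub_sq hXk y
  have h2 : ∫ ω in S, ‖regStep f a l (X k ω) - regStep f a l y‖ ^ 2 ∂P
      ≤ (1 - 2 * (a * l) + a ^ 2 * (L + l) ^ 2) * ∫ ω in S, ‖X k ω - y‖ ^ 2 ∂P := by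
    rw [← integral_const_mul]
    exact setIntegral_mono ((memLp_two_iff_integrable_sq_norm hw.1).1 hw).integrableOn
      (hV.const_mul _).integrableOn fun ω => hf.norm_regStep_sub_sq_le hL hα hlam _ _
  have hGint := (((integrable_norm_sub_sq hXk xs).const_mul L).const_mul A).add
    (integrable_const (μ := P) C)
  have h3 : ∫ ω in S, ‖D (k + 1) ω‖ ^ 2 ∂P
      ≤ ∫ ω in S, (A * (L * ‖X k ω - xs‖ ^ 2) + C) ∂P :=
    setIntegral_norm_sq_le_of_condLExp_le (ℱ.le k) hDm.1 hGint
      (ae_of_all _ fun ω => by simp only [Pi.zero_apply, Pi.add_apply]; positivity)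
      (condLExp_noise_le hf hL hA hxs hD) hS
  have h4 : ∫ ω in S, (A * (L * ‖X k ω - xs‖ ^ 2) + C) ∂P
      ≤ ∫ ω in S, (2 * (A * L) * ‖X k ω - y‖ ^ 2 + (2 * (A * L) * R ^ 2 + C)) ∂P := by
    refine setIntegral_mono hGint.integrableOn
      ((hV.const_mul _).add (integrable_const _)).integrableOn fun ω => ?_
    -- Recentring at `y` splits the noise into a part to be absorbed by the contraction and a
    -- constant part.
    have h5 : ‖X k ω - xs‖ ^ 2 ≤ 2 * ‖X k ω - y‖ ^ 2 + 2 * R ^ 2 := by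
      have h6 : ‖X k ω - xs‖ ≤ ‖X k ω - y‖ + R :=
        (norm_sub_le_norm_sub_add_norm_sub _ y _).trans (by gcongr)
      calc _ ≤ (‖X k ω - y‖ + R) ^ 2 := pow_le_pow_left₀ (norm_nonneg _) h6 2
        _ ≤ _ := by linarith [sq_nonneg (‖X k ω - y‖ - R)]
    have h7 := mul_le_mul_of_nonneg_left h5 (mul_nonneg hA hL0.le)
    simp only
    linarith
  rw [integral_add (hV.const_mul _).integrableOn (integrable_const _), integral_const_mul,
    setIntegral_const, smul_eq_mul] at h4
  rw [h1, setIntegral_norm_sub_smul_sq (ℱ.le k) hwm hw hDm (hX.noise_condExp k) a hS]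
  have h8 := mul_le_mul_of_nonneg_left (h3.trans h4) (sq_nonneg a)
  linarith

end Stochastic

/-! ### Assembling the almost sure rates -/

section Rates

variable {E : Type*} [NormedAddCommGroup E] [InnerProductSpace ℝ E] [CompleteSpace E]
  {Ω : Type*} {mΩ : MeasurableSpace Ω} {P : Measure Ω} [IsProbabilityMeasure P]
  {ℱ : Filtration ℕ mΩ} {f : E → ℝ} {X D : ℕ → Ω → E} {Ca Cl p q : ℝ}

/-- Almost sure rate for the distance between the stochastic and the deterministic iterates. -/
lemma IsRegSGD.ae_exists_eventually_norm_sub_gdIter_sq_le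
    (hX : IsRegSGD P ℱ f (fun k => Ca * (k : ℝ) ^ (-q)) (fun k => Cl * (k : ℝ) ^ (-p)) X D)
    (hf : SmoothConvex f) {xs : E} (hxs : IsMinOn f univ xs) (hD : ABCCondition P ℱ f xs X D)
    (hCa : 0 < Ca) (hCl : 0 < Cl) (hp0 : 0 < p) (hpq : p < q) (hqp : q + p < 1) {y : ℕ → E}
    (hy : ∀ k, y (k + 1) =
      regStep f (Ca * ((k + 1 : ℕ) : ℝ) ^ (-q)) (Cl * ((k + 1 : ℕ) : ℝ) ^ (-p)) (y k))
    {R : ℝ} (hR : ∀ᶠ k in atTop, ‖y k - xs‖ ≤ R) {β : ℝ} (hβ0 : 0 ≤ β) (hβ : β < 2 * q - 1) :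
    ∀ᵐ ω ∂P, ∃ B : ℝ, ∀ᶠ k : ℕ in atTop, ‖X k ω - y k‖ ^ 2 ≤ B * (k : ℝ) ^ (-β) := by
  have hmem := hX.memLp hf hxs hD
  obtain ⟨L, hL0, hL⟩ := hf.smooth
  obtain ⟨A, C, hA, hC, hD⟩ := hD
  set K := 2 * (A * L) * R ^ 2 + C with hK
  have hK0 : 0 ≤ K := by positivity
  have hsm := (tendsto_add_atTop_nat 1).eventually
    (eventually_sq_mul_le hCa hCl hpq ((L + Cl) ^ 2 + 2 * (A * L)))
  have hw := eventually_rpow_add_one_mul_le hβ0 (by linarith : β ≤ 1)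
    (by positivity : 0 < Ca * Cl / 2) hqp
  obtain ⟨N, hN⟩ := eventually_atTop.1 (hsm.and (hw.and (hR.and (eventually_ge_atTop 1))))
  have hbound := ae_exists_forall_le_of_setIntegral_succ_le (P := P) (ℱ := ℱ) (N := N)
    (Y := fun k ω => (k : ℝ) ^ β * ‖X k ω - y k‖ ^ 2)
    -- The factor `2` comes from `(k + 1)^β ≤ 2 k^β`; summability is exactly `β < 2 * q - 1`.
    (u := fun k => 2 * (Ca ^ 2 * K) * (k : ℝ) ^ (β - 2 * q))
    (fun k => (((hX.adapted k).sub stronglyMeasurable_const).norm.pow 2).const_mul _)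
    (fun k => (integrable_norm_sub_sq (hmem k) (y k)).const_mul _)
    (fun k ω => by positivity) (fun k => by positivity)
    ((Real.summable_nat_rpow.2 (by linarith)).mul_left _) ?_
  · filter_upwards [hbound] with ω ⟨B, hB⟩
    refine ⟨B, eventually_atTop.2 ⟨N, fun k hk => ?_⟩⟩
    have hk0 : (0 : ℝ) < k := by exact_mod_cast (hN k hk).2.2.2
    have := hB k hk
    rw [Real.rpow_neg hk0.le, ← div_eq_mul_inv, le_div_iff₀ (by positivity)]
    linarith
  · intro k hk S hS
    obtain ⟨h1, h2, h3, h4⟩ := hN k hk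
    have hk1 : (1 : ℝ) ≤ k := by exact_mod_cast h4
    have hk0 : (0 : ℝ) < k := by linarith
    have hk2 : (1 : ℝ) ≤ ((k + 1 : ℕ) : ℝ) := by push_cast; linarith
    have hstep := hX.setIntegral_norm_sub_regStep_sq_le hf hL0 hL hA hC hxs (hmem k) (hD k)
      (by positivity) (by positivity) h3 hS
    rw [← hy k, ← hK] at hstep
    have hlCl := mul_rpow_neg_le hCl.le hk2 hp0.le
    have hal := half_mul_rpow_neg_le_mul hCa hCl hk1 (by linarith : 0 ≤ q + p) hqp.le
    have haq : (Ca * ((k : ℝ) + 1) ^ (-q)) ^ 2 ≤ Ca ^ 2 * (k : ℝ) ^ (-(2 * q)) := by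
      have e : (k : ℝ) ^ (-(2 * q)) = ((k : ℝ) ^ (-q)) ^ 2 := by
        rw [← Real.rpow_natCast, ← Real.rpow_mul hk0.le]; congr 1; push_cast; ring
      rw [e, ← mul_pow]
      refine pow_le_pow_left₀ (by positivity) (mul_le_mul_of_nonneg_left ?_ hCa.le) 2
      exact Real.rpow_le_rpow_of_nonpos hk0 (by linarith) (by linarith)
    rw [← Nat.cast_add_one] at hal haq
    set a := Ca * ((k + 1 : ℕ) : ℝ) ^ (-q)
    set l := Cl * ((k + 1 : ℕ) : ℝ) ^ (-p)
    set I := ∫ ω in S, ‖X k ω - y k‖ ^ 2 ∂P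
    have hI : 0 ≤ I := integral_nonneg fun ω => sq_nonneg _
    have hl0 : 0 < l := by positivity
    -- One of the two copies of `a * l` absorbs the second-order terms; the other keeps half its
    -- size after the index shift.
    have hrho : 1 - 2 * (a * l) + a ^ 2 * ((L + l) ^ 2 + 2 * (A * L))
        ≤ 1 - Ca * Cl / 2 * (k : ℝ) ^ (-(q + p)) := by
      have : a ^ 2 * ((L + l) ^ 2 + 2 * (A * L)) ≤ a * l := le_trans (by gcongr) h1
      linarith
    have hgrow : ((k : ℝ) + 1) ^ β ≤ 2 * (k : ℝ) ^ β := by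
      have h5 := rpow_add_one_le hk0 hβ0 (by linarith : β ≤ 1)
      have h6 : 1 / (k : ℝ) ≤ 1 := by rw [div_le_one hk0]; exact hk1
      have h7 : 0 ≤ (k : ℝ) ^ β := by positivity
      nlinarith
    simp only [integral_const_mul]
    calc ((k + 1 : ℕ) : ℝ) ^ β * ∫ ω in S, ‖X (k + 1) ω - y (k + 1)‖ ^ 2 ∂P
        ≤ ((k : ℝ) + 1) ^ β * ((1 - Ca * Cl / 2 * (k : ℝ) ^ (-(q + p))) * I
            + Ca ^ 2 * (k : ℝ) ^ (-(2 * q)) * K * P.real S) := by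
          rw [Nat.cast_add_one]
          gcongr
          exact hstep.trans (by gcongr)
      _ = (((k : ℝ) + 1) ^ β * (1 - Ca * Cl / 2 * (k : ℝ) ^ (-(q + p)))) * I
            + ((k : ℝ) + 1) ^ β * (Ca ^ 2 * (k : ℝ) ^ (-(2 * q)) * K * P.real S) := by ring
      _ ≤ (k : ℝ) ^ β * I
            + 2 * (k : ℝ) ^ β * (Ca ^ 2 * (k : ℝ) ^ (-(2 * q)) * K * P.real S) := by gcongr
      _ = _ := by
          rw [sub_eq_add_neg β, Real.rpow_add hk0]; ring

omit [InnerProductSpace ℝ E] [CompleteSpace E] in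
lemma norm_sub_sq_le_three_mul (x y z w : E) :
    ‖x - w‖ ^ 2 ≤ 3 * (‖x - y‖ ^ 2 + ‖y - z‖ ^ 2 + ‖z - w‖ ^ 2) := by
  have h : ‖x - w‖ ≤ ‖x - y‖ + ‖y - z‖ + ‖z - w‖ := by
    have := norm_add₃_le (a := x - y) (b := y - z) (c := z - w)
    rwa [sub_add_sub_cancel, sub_add_sub_cancel] at this
  have h2 := pow_le_pow_left₀ (norm_nonneg _) h 2
  nlinarith [sq_nonneg (‖x - y‖ - ‖y - z‖), sq_nonneg (‖x - y‖ - ‖z - w‖),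
    sq_nonneg (‖y - z‖ - ‖z - w‖)]

/-- Almost sure convergence rate of regularized stochastic gradient descent to the minimum norm
solution. -/
theorem IsRegSGD.ae_isBigO
    (hX : IsRegSGD P ℱ f (fun k => Ca * (k : ℝ) ^ (-q)) (fun k => Cl * (k : ℝ) ^ (-p)) X D)
    (hf : SmoothConvex f) {xs : E} (hxs : IsMinOn f univ xs) (hD : ABCCondition P ℱ f xs X D)
    (hCa : 0 < Ca) (hCl : 0 < Cl) (hp0 : 0 < p) (hpq : p < q) (hqp : q + p < 1)
    {ξ : ℝ} (hrate : TikhonovRate f xs ξ) {β : ℝ} (hβ0 : 0 ≤ β) (hβ : β < 2 * q - 1) :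
    ∀ᵐ ω ∂P, (fun k : ℕ => ‖X k ω - xs‖ ^ 2) =O[atTop]
      (fun k : ℕ => (k : ℝ) ^ (-min (1 - q - p) (min (β - p) (2 * ξ * p)))) := by
  have hex : ∀ k : ℕ, ∃ x : E, 1 ≤ k → ∇ f x + (Cl * (k : ℝ) ^ (-p)) • x = 0 := fun k => by
    rcases Nat.eq_zero_or_pos k with rfl | hk
    · exact ⟨0, fun h => by omega⟩
    · have hk0 : (0 : ℝ) < k := by exact_mod_cast hk
      obtain ⟨x, hx⟩ := hf.exists_stationary (l := Cl * (k : ℝ) ^ (-p)) (by positivity)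
      exact ⟨x, fun _ => hx⟩
  choose xl hxl using hex
  have hlpos : ∀ k : ℕ, 1 ≤ k → 0 < Cl * (k : ℝ) ^ (-p) := fun k hk => by
    have hk0 : (0 : ℝ) < k := by exact_mod_cast hk
    positivity
  have hmin : ∀ k : ℕ, 1 ≤ k → IsMinOn (tikhonov f (Cl * (k : ℝ) ^ (-p))) univ (xl k) :=
    fun k hk => hf.isMinOn_tikhonov (hlpos k hk).le (hxl k hk)
  have hxlR : ∀ k : ℕ, 1 ≤ k → ‖xl k‖ ≤ ‖xs‖ := fun k hk =>
    norm_le_of_isMinOn_tikhonov (hlpos k hk) hxs (hmin k hk)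
  obtain ⟨M, hM⟩ := hf.exists_eventually_norm_gdIter_sub_le hCa hCl hp0 (by linarith) hpq hqp
    hxl hxlR
  set y := gdIter f (fun k => Ca * (k : ℝ) ^ (-q)) (fun k => Cl * (k : ℝ) ^ (-p))
  -- Boundedness of the reference keeps the constant part of the noise bound uniform in `k`.
  have hyR : ∀ᶠ k in atTop, ‖y k - xs‖ ≤ |M| + (‖xs‖ + ‖xs‖) := by
    filter_upwards [hM, eventually_ge_atTop 1] with k h1 h2
    have hk : (1 : ℝ) ≤ k := by exact_mod_cast h2
    have h3 : M * (k : ℝ) ^ (-(1 - (q + p))) ≤ |M| :=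
      (mul_le_mul_of_nonneg_right (le_abs_self M) (by positivity)).trans
        (mul_rpow_neg_le (abs_nonneg M) hk (by linarith))
    refine (norm_sub_le_norm_sub_add_norm_sub _ (xl k) _).trans ?_
    gcongr
    · exact h1.trans h3
    · exact (norm_sub_le _ _).trans (by gcongr; exact hxlR k h2)
  obtain ⟨Creg, hCreg, hreg⟩ := hrate
  have hl1 : ∀ᶠ k : ℕ in atTop, Cl * (k : ℝ) ^ (-p) ≤ 1 := by
    have := (tendsto_natCast_rpow_neg hp0).const_mul Cl
    rw [mul_zero] at this
    exact this.eventually_le_const one_pos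
  filter_upwards [hX.ae_exists_eventually_norm_sub_gdIter_sq_le hf hxs hD hCa hCl hp0 hpq hqp
    (fun k => rfl) hyR hβ0 hβ] with ω ⟨B, hB⟩
  set r := min (1 - q - p) (min (β - p) (2 * ξ * p))
  have hr1 : r ≤ 1 - q - p := min_le_left _ _
  have hr2 : r ≤ β - p := (min_le_right _ _).trans (min_le_left _ _)
  have hr3 : r ≤ 2 * ξ * p := (min_le_right _ _).trans (min_le_right _ _)
  -- The three squared errors decay with exponents `β`, `2(1-q-p)` and `2ξp`, each at least `r`
  -- since `p` and `1-q-p` are positive.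
  refine IsBigO.of_bound (3 * (|B| + M ^ 2 + (Creg * Cl ^ ξ) ^ 2)) ?_
  filter_upwards [hB, hM, hl1, eventually_ge_atTop 1] with k h1 h2 h3 h4
  have hk1 : (1 : ℝ) ≤ k := by exact_mod_cast h4
  have hk0 : (0 : ℝ) < k := by linarith
  have e1 : ‖X k ω - y k‖ ^ 2 ≤ |B| * (k : ℝ) ^ (-r) := by
    refine h1.trans ?_
    gcongr
    · exact le_abs_self B
    · linarith
  have e2 : ‖y k - xl k‖ ^ 2 ≤ M ^ 2 * (k : ℝ) ^ (-r) := by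
    refine (pow_le_pow_left₀ (norm_nonneg _) h2 2).trans ?_
    rw [mul_pow, ← Real.rpow_natCast ((k : ℝ) ^ _) 2, ← Real.rpow_mul hk0.le]
    gcongr
    push_cast; linarith
  have e3 : ‖xl k - xs‖ ^ 2 ≤ (Creg * Cl ^ ξ) ^ 2 * (k : ℝ) ^ (-r) := by
    refine (pow_le_pow_left₀ (norm_nonneg _)
      (hreg _ ⟨hlpos k h4, h3⟩ (xl k) (hmin k h4)) 2).trans ?_
    rw [Real.mul_rpow hCl.le (by positivity), ← mul_assoc, mul_pow,
      ← Real.rpow_natCast (((k : ℝ) ^ _) ^ ξ) 2, ← Real.rpow_mul hk0.le, ← Real.rpow_mul hk0.le]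
    gcongr
    push_cast; linarith
  rw [Real.norm_of_nonneg (by positivity), Real.norm_of_nonneg (by positivity)]
  refine (norm_sub_sq_le_three_mul _ (y k) (xl k) _).trans ?_
  linarith

end Rates

end RegSGD

theorem mainTheorem6
    {E : Type*} [NormedAddCommGroup E] [InnerProductSpace ℝ E] [CompleteSpace E]
    [TopologicalSpace.SeparableSpace E]
    {Ω : Type*} {mΩ : MeasurableSpace Ω} (P : Measure Ω) [IsProbabilityMeasure P]
    (ℱ : Filtration ℕ mΩ)
    (f : E → ℝ) (hf : RegSGD.SmoothConvex f)
    (xs : E) (hxs : RegSGD.IsMinNormSolution f xs)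
    (Cα Cl p q : ℝ) (hCα : 0 < Cα) (hCl : 0 < Cl)
    (hp : p ∈ Ioo (0 : ℝ) (1 / 3)) (hq : q ∈ Ioo ((p + 1) / 2) (1 - p))
    (X D : ℕ → Ω → E)
    (hX : RegSGD.IsRegSGD P ℱ f (fun k => Cα * (k : ℝ) ^ (-q)) (fun k => Cl * (k : ℝ) ^ (-p)) X D)
    (hD : RegSGD.ABCCondition P ℱ f xs X D)
    (ξ : ℝ) (hξ : 0 < ξ) (hrate : RegSGD.TikhonovRate f xs ξ) :
    (∀ β ∈ Ioo (0 : ℝ) (2 * q - 1), ∀ᵐ ω ∂P,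
      (fun k : ℕ => ‖X k ω - xs‖ ^ 2) =O[atTop]
        (fun k : ℕ => (k : ℝ) ^ (-min (1 - q - p) (min (β - p) (2 * ξ * p))))) ∧
    (q = 2 / 3 → p = 1 / (6 * ξ + 3) → ∀ ε : ℝ, 0 < ε → ∀ᵐ ω ∂P,
      (fun k : ℕ => ‖X k ω - xs‖ ^ 2) =O[atTop]
        (fun k : ℕ => (k : ℝ) ^ (-(2 * ξ / (6 * ξ + 3) - ε)))) := by
  obtain ⟨hp0, hp1⟩ := hp
  obtain ⟨hq0, hq1⟩ := hq
  have main : ∀ β ∈ Ioo (0 : ℝ) (2 * q - 1), ∀ᵐ ω ∂P,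
      (fun k : ℕ => ‖X k ω - xs‖ ^ 2) =O[atTop]
        (fun k : ℕ => (k : ℝ) ^ (-min (1 - q - p) (min (β - p) (2 * ξ * p)))) := fun β hβ =>
    hX.ae_isBigO hf hxs.1 hD hCα hCl hp0 (by linarith) (by linarith) hrate hβ.1.le hβ.2
  refine ⟨main, fun hq hp ε hε => ?_⟩
  -- Within `ε` of the excluded endpoint `2q - 1 = 1/3`; the `1 / 6` keeps `β` positive when `ε` is
  -- large.
  set β := max (1 / 3 - ε) (1 / 6)
  have hβ1 : 1 / 3 - ε ≤ β := le_max_left _ _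
  have hβ6 : 1 / 6 ≤ β := le_max_right _ _
  have hβ2 : β < 1 / 3 := max_lt (by linarith) (by norm_num)
  filter_upwards [main β ⟨by linarith, by rw [hq]; linarith⟩] with ω h
  refine h.trans (IsBigO.of_bound 1 ?_)
  filter_upwards [eventually_ge_atTop 1] with k hk
  have hk1 : (1 : ℝ) ≤ k := by exact_mod_cast hk
  rw [Real.norm_of_nonneg (by positivity), Real.norm_of_nonneg (by positivity), one_mul]
  refine Real.rpow_le_rpow_of_exponent_le hk1 (neg_le_neg (le_min ?_ (le_min ?_ ?_)))
  -- This `p` balances the rates: `1 - q - p` and `2ξp` both equal `1/3 - p`, and `β - p` falls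
  -- short by at most `ε`.
  all_goals
    have e1 : 2 * ξ / (6 * ξ + 3) = 1 / 3 - p := by rw [hp]; field_simp; ring
    have e2 : 2 * ξ * p = 1 / 3 - p := by rw [hp]; field_simp; ring
    rw [e1]
    linarith
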